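/- Fix the scalar field $\mathbb{K}=\mathbb{R}$ or $\mathbb{C}$. For an infinite cardinal number $\kappa$ (identified with its initial ordinal), let $\ell_\infty^c(\kappa)$ be the Banach space of all bounded functions $z\colon\kappa\to\mathbb{K}$ such that $z(\alpha)\neq 0$ for at most countably many $\alpha<\kappa$, with the supremum norm. For a Banach space $X$, let $\mathscr{B}(X)$ be the algebra of bounded linear operators on $X$, with the operator norm. An operator $T\in\mathscr{B}(X)$ is weakly compact if the image under $T$ of the closed unit ball of $X$ is relatively compact in the weak topology of $X$. For a Banach space $E$, let $\mathscr{S}_E(X)$ be the set of those $T\in\mathscr{B}(X)$ that are not bounded below on any copy of $E$, that is, those for which there are no linear subspace $E_0\subseteq X$ isomorphic (linearly homeomorphic) to $E$ and constant $c>0$ with $\|Tx\|\geqslant c\|x\|$ for all $x\in E_0$. Theorem. Let $\lambda$ be an infinite cardinal number, with cardinal successor $\lambda^+$. Then every norm-closed two-sided ideal of $\mathscr{B}(\ell_\infty^c(\lambda))$ that contains all weakly compact operators is equal to $\mathscr{S}_{\ell_\infty^c(\kappa)}(\ell_\infty^c(\lambda))$ for some infinite cardinal number $\kappa\leqslant\lambda^+$.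 -/

import Mathlib

open scoped ENNReal Cardinal

universe u v w

/-- The subspace of `ℓ_∞(Γ)` (bounded scalar functions on `Γ` with the supremum norm) consisting of
the functions that take non-zero values at no more than countably many points. -/
def countablySupported (𝕜 : Type v) [RCLike 𝕜] (Γ : Type u) :
    Submodule 𝕜 (lp (fun _ : Γ => 𝕜) ∞) where
  carrier := {z | {γ : Γ | z γ ≠ 0}.Countable}
  zero_mem' := by simp
  add_mem' := by
    intro y z hy hz
    refine (Set.Countable.union hy hz).mono fun γ hγ => ?_
    by_contra h
    simp only [Set.mem_union, Set.mem_ofPred_eq, not_or, not_not] at h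
    exact hγ (by simp [h.1, h.2])
  smul_mem' := by
    intro c z hz
    refine Set.Countable.mono (fun γ hγ => ?_) hz
    intro h
    exact hγ (by simp [h])

/-- The space `ℓ_∞^c(Γ)` of bounded functions with countable support on a set `Γ`. -/
def LInftyC (𝕜 : Type v) [RCLike 𝕜] (Γ : Type u) : Type (max u v) :=
  countablySupported 𝕜 Γ

/-- The norm of `ℓ_∞^c(Γ)` is the supremum norm inherited from `ℓ_∞(Γ)`. -/
noncomputable instance (𝕜 : Type v) [RCLike 𝕜] (Γ : Type u) : NormedAddCommGroup (LInftyC 𝕜 Γ) :=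
  inferInstanceAs (NormedAddCommGroup (countablySupported 𝕜 Γ))

noncomputable instance (𝕜 : Type v) [RCLike 𝕜] (Γ : Type u) : NormedSpace 𝕜 (LInftyC 𝕜 Γ) :=
  inferInstanceAs (NormedSpace 𝕜 (countablySupported 𝕜 Γ))

/-- The space `ℓ_∞^c(κ)` of a cardinal `κ`: the index set is the set of ordinals below the initial
ordinal of `κ`. -/
abbrev EllInftyC (𝕜 : Type v) [RCLike 𝕜] (κ : Cardinal.{u}) : Type (max u v) :=
  LInftyC 𝕜 κ.ord.ToType

section Operators

variable {𝕜 : Type v} [RCLike 𝕜]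
  {X : Type u} [NormedAddCommGroup X] [NormedSpace 𝕜 X]
  {Y : Type w} [NormedAddCommGroup Y] [NormedSpace 𝕜 Y]

/-- The bounded operator `T` is weakly compact: the image of the closed unit ball is relatively
compact in the weak topology of the codomain. -/
def IsWeaklyCompactOperator (T : X →L[𝕜] Y) : Prop :=
  IsCompact (closure (toWeakSpace 𝕜 Y '' (T '' Metric.closedBall (0 : X) 1)))

/-- `T` is bounded below on a copy of `E`: some linear subspace `E₀` of the domain is linearly
homeomorphic to `E`, and `‖T x‖ ≥ c ‖x‖` on `E₀` for some constant `c > 0`. -/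
def IsBoundedBelowOnCopyOf (E : Type*) [NormedAddCommGroup E] [NormedSpace 𝕜 E]
    (T : X →L[𝕜] Y) : Prop :=
  ∃ E₀ : Submodule 𝕜 X, Nonempty (E ≃L[𝕜] E₀) ∧
    ∃ c : ℝ, 0 < c ∧ ∀ x ∈ E₀, c * ‖x‖ ≤ ‖T x‖

variable (𝕜) in
/-- The set `𝒮_E(X)` of the `E`-singular operators on `X`: the bounded operators on `X` that are not
bounded below on any copy of `E`. -/
def singularOperators (E : Type*) [NormedAddCommGroup E] [NormedSpace 𝕜 E]
    (X : Type u) [NormedAddCommGroup X] [NormedSpace 𝕜 X] : Set (X →L[𝕜] X) :=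
  {T | ¬ IsBoundedBelowOnCopyOf E T}

end Operators

/-! Write `X = ℓ_∞^c(λ)`, let `P_A` be the projection of `X` onto the functions supported in `A`,
and let `e_i` be the unit vectors.

*Factorization.* Let `V : ℓ_∞^c(I) → ℓ_∞^c(Λ)` satisfy `‖V e_i‖ > δ` for all `i` in the infinite
set `I`. Choose coordinate functionals `ν_i` of `V` with `|ν_i(e_i)| > δ`. Rosenthal's lemma
(`LInftyC.exists_injective_variation_le`) gives a subset `I'` of full cardinality such that `ν_i`
has variation at most `δ / 2` on `I' \ {i}` for `i ∈ I'`. Then `y ↦ (y(γ_i) / ν_i(e_i))_i`, where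
`γ_i` is the coordinate defining `ν_i`, is up to an operator of norm at most `1 / 2` a left
inverse of the restriction of `V` to `ℓ_∞^c(I')`; it takes values in `ℓ_∞^c(I')` because each
coordinate is used only finitely often. Hence `V` factors the identity of `ℓ_∞^c(I)`
(`LInftyC.exists_comp_comp_eq_id_of_lt_norm_single`). Two consequences: an ideal that contains an
operator fixing a copy of `ℓ_∞^c(κ)` contains every operator that factors through `ℓ_∞^c(κ)`, and
an operator that has norm larger than `δ` on `κ` disjoint bands fixes a copy of `ℓ_∞^c(κ)`.

*The ideals.* Given `J`, let `κ` be the least infinite cardinal such that no member of `J` fixes a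
copy of `ℓ_∞^c(κ)`; it is at most `λ⁺`, because `ℓ_∞^c(λ⁺)` does not embed into `X`. Let `T` fix
no copy of `ℓ_∞^c(κ)`. If `κ` is uncountable, then for every `ε > 0` a maximal disjoint family of
countable sets `A` with `‖T P_A‖ > ε` has fewer than `κ` members, and so does its union `S`; by
maximality `‖T - T P_S‖ ≤ ε`, while `T P_S` factors through `ℓ_∞^c(μ)` for some `μ < κ` and hence
lies in `J`. As `J` is closed, `T ∈ J`.

*Weak compactness.* If `κ = ℵ₀`, then `T` is weakly compact, and so belongs to `J`
(`LInftyC.isWeaklyCompactOperator_of_not_isBoundedBelowOnCopyOf`). Since `T` fixes no copy of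
`ℓ_∞`, `‖T P_A‖` tends to zero along disjoint sequences. A disjointification argument
(`exists_disjoint_lt_of_dominated`) then yields, for every `ε`, finitely many coordinate
functionals `ν` of `T` such that `‖T f‖ ≤ ε` for all `f` in the unit ball with `q(f) = ∑
|ν|(|f|²)` small enough. As `q` satisfies the parallelogram law, near-minimizers of `q` in
midpoint-convex sets are close to each other, and this uniform convexity replaces the reflexivity
of a Hilbert space in the proof that `T` is weakly compact
(`isWeaklyCompactOperator_of_parallelogram`). -/

/-! ### Coordinates and weighted composition operators -/

namespace LInftyC

variable {𝕜 : Type v} [RCLike 𝕜] {Γ I : Type*}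

/-- The function underlying an element of `ℓ_∞^c(Γ)`. -/
def toFun (x : LInftyC 𝕜 Γ) : Γ → 𝕜 :=
  (Subtype.val (p := fun z : lp (fun _ : Γ => 𝕜) ∞ => z ∈ countablySupported 𝕜 Γ) x).1

instance : CoeFun (LInftyC 𝕜 Γ) fun _ => Γ → 𝕜 := ⟨toFun⟩

@[simp] lemma add_apply (x y : LInftyC 𝕜 Γ) (γ : Γ) : (x + y) γ = x γ + y γ := rfl

@[simp] lemma sub_apply (x y : LInftyC 𝕜 Γ) (γ : Γ) : (x - y) γ = x γ - y γ := rfl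

@[simp] lemma smul_apply (c : 𝕜) (x : LInftyC 𝕜 Γ) (γ : Γ) : (c • x) γ = c * x γ := rfl

@[simp] lemma zero_apply (γ : Γ) : (0 : LInftyC 𝕜 Γ) γ = 0 := rfl

@[ext] lemma ext {x y : LInftyC 𝕜 Γ} (h : ∀ γ, x γ = y γ) : x = y :=
  Subtype.ext (lp.ext (funext h))

lemma norm_apply_le (x : LInftyC 𝕜 Γ) (γ : Γ) : ‖x γ‖ ≤ ‖x‖ :=
  lp.norm_apply_le_norm ENNReal.top_ne_zero _ γ

lemma norm_le {x : LInftyC 𝕜 Γ} {C : ℝ} (hC : 0 ≤ C) (h : ∀ γ, ‖x γ‖ ≤ C) : ‖x‖ ≤ C :=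
  lp.norm_le_of_forall_le hC h

lemma exists_lt_norm_apply {x : LInftyC 𝕜 Γ} {C : ℝ} (hC : 0 ≤ C) (h : C < ‖x‖) :
    ∃ γ, C < ‖x γ‖ := by
  by_contra! hx
  exact h.not_ge (norm_le hC hx)

lemma countable_support (x : LInftyC 𝕜 Γ) : {γ | x γ ≠ 0}.Countable := x.2

/-- The element of `ℓ_∞^c(Γ)` with prescribed values. -/
def ofFun (f : Γ → 𝕜) (hb : ∃ C, ∀ γ, ‖f γ‖ ≤ C) (hc : {γ | f γ ≠ 0}.Countable) : LInftyC 𝕜 Γ :=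
  (⟨⟨f, memℓp_infty (hb.imp fun _ hC => by rintro _ ⟨γ, rfl⟩; exact hC γ)⟩, hc⟩ :
    countablySupported 𝕜 Γ)

@[simp] lemma ofFun_apply (f : Γ → 𝕜) (hb : ∃ C, ∀ γ, ‖f γ‖ ≤ C)
    (hc : {γ | f γ ≠ 0}.Countable) (γ : Γ) : ofFun f hb hc γ = f γ := rfl

instance : CompleteSpace (LInftyC 𝕜 Γ) := by
  have hcl : IsClosed (countablySupported 𝕜 Γ : Set (lp (fun _ : Γ => 𝕜) ∞)) := by
    refine IsSeqClosed.isClosed fun f a hf hfa => ?_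
    refine (Set.countable_iUnion fun n => hf n).mono fun γ hγ => ?_
    by_contra hn
    simp only [Set.mem_iUnion, Set.mem_ofPred_eq, not_exists, not_not] at hn
    obtain ⟨n, hn'⟩ := ((tendsto_iff_norm_sub_tendsto_zero.1 hfa).eventually_lt_const
      (norm_pos_iff.2 hγ)).exists
    have h1 := lp.norm_apply_le_norm ENNReal.top_ne_zero (f n - a) γ
    rw [lp.coeFn_sub, Pi.sub_apply, hn n, zero_sub, norm_neg] at h1
    exact absurd h1 (not_le.2 hn')
  exact hcl.completeSpace_coe

/-- The evaluation functional at `γ`. -/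
noncomputable def coord (γ : Γ) : LInftyC 𝕜 Γ →L[𝕜] 𝕜 :=
  LinearMap.mkContinuous
    { toFun := fun x => x γ, map_add' := fun _ _ => rfl, map_smul' := fun _ _ => rfl } 1
    fun x => (norm_apply_le x γ).trans_eq (one_mul _).symm

@[simp] lemma coord_apply (γ : Γ) (x : LInftyC 𝕜 Γ) : coord γ x = x γ := rfl

lemma norm_coord_le (γ : Γ) : ‖(coord γ : LInftyC 𝕜 Γ →L[𝕜] 𝕜)‖ ≤ 1 :=
  ContinuousLinearMap.opNorm_le_bound _ zero_le_one fun x => by simpa using norm_apply_le x γ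

/-- The weighted composition operator `x ↦ w · (x ∘ φ)`. The countability condition keeps the
supports countable. -/
noncomputable def weightedComp (φ : Γ → I) (w : Γ → 𝕜) (hw : ∃ C, ∀ γ, ‖w γ‖ ≤ C)
    (hc : ∀ i, {γ | φ γ = i ∧ w γ ≠ 0}.Countable) : LInftyC 𝕜 I →L[𝕜] LInftyC 𝕜 Γ :=
  have hC : ∀ (x : LInftyC 𝕜 I) (γ : Γ), ‖w γ * x (φ γ)‖ ≤ max hw.choose 0 * ‖x‖ := fun x γ => by
    rw [norm_mul]
    exact mul_le_mul ((hw.choose_spec γ).trans (le_max_left _ _)) (norm_apply_le x _)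
      (norm_nonneg _) (le_max_right _ _)
  LinearMap.mkContinuous
    { toFun := fun x => ofFun (fun γ => w γ * x (φ γ)) ⟨_, hC x⟩
        ((x.countable_support.biUnion fun i _ => hc i).mono fun γ hγ => by
          simp only [Set.mem_iUnion, Set.mem_ofPred_eq] at hγ ⊢
          exact ⟨φ γ, right_ne_zero_of_mul hγ, rfl, left_ne_zero_of_mul hγ⟩)
      map_add' := fun x y => by ext γ; simp [mul_add]
      map_smul' := fun c x => by ext γ; simp [mul_left_comm] }
    (max hw.choose 0)
    fun x => norm_le (by positivity) (hC x)

@[simp] lemma weightedComp_apply (φ : Γ → I) (w : Γ → 𝕜) (hw : ∃ C, ∀ γ, ‖w γ‖ ≤ C)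
    (hc : ∀ i, {γ | φ γ = i ∧ w γ ≠ 0}.Countable) (x : LInftyC 𝕜 I) (γ : Γ) :
    weightedComp φ w hw hc x γ = w γ * x (φ γ) := rfl

/-- Multiplication by the bounded function `w`. -/
noncomputable def mulOp (w : Γ → 𝕜) (hw : ∃ C, ∀ γ, ‖w γ‖ ≤ C) : LInftyC 𝕜 Γ →L[𝕜] LInftyC 𝕜 Γ :=
  weightedComp id w hw fun i => (Set.countable_singleton i).mono fun _ h => h.1

@[simp] lemma mulOp_apply (w : Γ → 𝕜) (hw : ∃ C, ∀ γ, ‖w γ‖ ≤ C) (x : LInftyC 𝕜 Γ) (γ : Γ) :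
    mulOp w hw x γ = w γ * x γ := rfl

/-- The projection `x ↦ 1_A x` onto the functions supported in `A`. -/
noncomputable def proj (A : Set Γ) : LInftyC 𝕜 Γ →L[𝕜] LInftyC 𝕜 Γ :=
  mulOp (A.indicator 1) ⟨1, fun γ => by by_cases h : γ ∈ A <;> simp [h]⟩

lemma proj_apply_of_mem {A : Set Γ} {γ : Γ} (h : γ ∈ A) (x : LInftyC 𝕜 Γ) : proj A x γ = x γ := by
  simp [proj, h]

lemma proj_apply_of_notMem {A : Set Γ} {γ : Γ} (h : γ ∉ A) (x : LInftyC 𝕜 Γ) :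
    proj A x γ = 0 := by
  simp [proj, h]

lemma norm_proj_apply_le (A : Set Γ) (x : LInftyC 𝕜 Γ) : ‖proj A x‖ ≤ ‖x‖ :=
  norm_le (norm_nonneg _) fun γ => by
    by_cases h : γ ∈ A
    · simpa [proj_apply_of_mem h] using norm_apply_le x γ
    · simp [proj_apply_of_notMem h]

lemma proj_proj (A B : Set Γ) (x : LInftyC 𝕜 Γ) : proj A (proj B x) = proj (A ∩ B) x := by
  ext γ
  by_cases hA : γ ∈ A <;> by_cases hB : γ ∈ B <;> simp [proj, hA, hB]

lemma proj_add_proj_compl (A : Set Γ) (x : LInftyC 𝕜 Γ) : proj A x + proj Aᶜ x = x := by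
  ext γ
  by_cases hA : γ ∈ A <;> simp [proj, hA]

open scoped Classical in
/-- The indicator function of the point `γ`. -/
noncomputable def single (γ : Γ) : LInftyC 𝕜 Γ :=
  ofFun (Pi.single γ 1) ⟨1, fun i => by by_cases h : i = γ <;> simp [h]⟩
    ((Set.countable_singleton γ).mono fun i hi => by
      by_contra h
      exact hi (Pi.single_eq_of_ne h _))

@[simp] lemma single_apply_self (γ : Γ) : (single γ : LInftyC 𝕜 Γ) γ = 1 := by simp [single]

lemma single_apply_of_ne {γ i : Γ} (h : i ≠ γ) : (single γ : LInftyC 𝕜 Γ) i = 0 := by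
  simp [single, h]

lemma norm_single_le (γ : Γ) : ‖(single γ : LInftyC 𝕜 Γ)‖ ≤ 1 :=
  norm_le zero_le_one fun i => by
    rcases eq_or_ne i γ with rfl | h
    · simp
    · simp [single_apply_of_ne h]

lemma proj_single (γ : Γ) : proj {γ} (single γ : LInftyC 𝕜 Γ) = single γ := by
  ext i
  rcases eq_or_ne i γ with rfl | h
  · rw [proj_apply_of_mem (Set.mem_singleton i)]
  · rw [proj_apply_of_notMem (by simpa using h), single_apply_of_ne h]

lemma exists_lt_norm_apply_of_lt_opNorm {X Y : Type*} [NormedAddCommGroup X] [NormedSpace 𝕜 X]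
    [NormedAddCommGroup Y] [NormedSpace 𝕜 Y] (T : X →L[𝕜] Y) {c : ℝ} (h : c < ‖T‖) :
    ∃ x, ‖x‖ ≤ 1 ∧ c < ‖T x‖ := by
  obtain ⟨x, hx, hx'⟩ := T.exists_lt_apply_of_lt_opNorm h
  exact ⟨x, hx.le, hx'⟩

/-! ### The variation of a functional -/

/-- `‖ν ∘ M_w‖` is the value `|ν|(w)` of the variation of `ν` at the weight `w ≥ 0`, and it is
additive in `w`. For the nontrivial inequality, `w₁ g₁ + w₂ g₂ = (w₁ + w₂) g` with `|g| ≤ 1`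
whenever `|g₁|, |g₂| ≤ 1`. -/
lemma norm_comp_mulOp_add (ν : LInftyC 𝕜 Γ →L[𝕜] 𝕜) (w₁ w₂ w : Γ → ℝ) (h₁ : ∀ γ, 0 ≤ w₁ γ)
    (h₂ : ∀ γ, 0 ≤ w₂ γ) (h : ∀ γ, w₁ γ + w₂ γ = w γ)
    (hb₁ : ∃ C, ∀ γ, ‖(w₁ γ : 𝕜)‖ ≤ C) (hb₂ : ∃ C, ∀ γ, ‖(w₂ γ : 𝕜)‖ ≤ C)
    (hb : ∃ C, ∀ γ, ‖(w γ : 𝕜)‖ ≤ C) :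
    ‖ν ∘L mulOp (fun γ => (w₁ γ : 𝕜)) hb₁‖ + ‖ν ∘L mulOp (fun γ => (w₂ γ : 𝕜)) hb₂‖ =
      ‖ν ∘L mulOp (fun γ => (w γ : 𝕜)) hb‖ := by
  apply le_antisymm
  · refine le_of_forall_pos_le_add fun ε hε => ?_
    obtain ⟨g₁, hg₁, hg₁'⟩ := exists_lt_norm_apply_of_lt_opNorm
      (ν ∘L mulOp (fun γ => (w₁ γ : 𝕜)) hb₁) (sub_lt_self _ (half_pos hε))
    obtain ⟨g₂, hg₂, hg₂'⟩ := exists_lt_norm_apply_of_lt_opNorm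
      (ν ∘L mulOp (fun γ => (w₂ γ : 𝕜)) hb₂) (sub_lt_self _ (half_pos hε))
    simp only [ContinuousLinearMap.comp_apply] at hg₁' hg₂'
    -- rotate both values to the positive real axis, so that the two norms add up
    obtain ⟨c₁, hc₁, e₁⟩ := RCLike.exists_norm_eq_mul_self (ν (mulOp (fun γ => (w₁ γ : 𝕜)) hb₁ g₁))
    obtain ⟨c₂, hc₂, e₂⟩ := RCLike.exists_norm_eq_mul_self (ν (mulOp (fun γ => (w₂ γ : 𝕜)) hb₂ g₂))
    have hle : ∀ γ, ‖(w₁ γ : 𝕜) * (c₁ * g₁ γ) + (w₂ γ : 𝕜) * (c₂ * g₂ γ)‖ ≤ w γ := fun γ => by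
      refine (norm_add_le _ _).trans ?_
      rw [norm_mul, norm_mul, norm_mul, norm_mul, hc₁, hc₂, RCLike.norm_of_nonneg (h₁ γ),
        RCLike.norm_of_nonneg (h₂ γ), ← h γ, one_mul, one_mul]
      exact add_le_add (mul_le_of_le_one_right (h₁ γ) ((norm_apply_le _ _).trans hg₁))
        (mul_le_of_le_one_right (h₂ γ) ((norm_apply_le _ _).trans hg₂))
    have hw : ∀ γ, 0 ≤ w γ := fun γ => h γ ▸ add_nonneg (h₁ γ) (h₂ γ)
    have hG : ∀ γ, ‖(w γ : 𝕜)⁻¹ * ((w₁ γ : 𝕜) * (c₁ * g₁ γ) + (w₂ γ : 𝕜) * (c₂ * g₂ γ))‖ ≤ 1 :=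
      fun γ => by
        rw [norm_mul, norm_inv, RCLike.norm_of_nonneg (hw γ)]
        exact inv_mul_le_one_of_le₀ (hle γ) (hw γ)
    let g : LInftyC 𝕜 Γ := ofFun
      (fun γ => (w γ : 𝕜)⁻¹ * ((w₁ γ : 𝕜) * (c₁ * g₁ γ) + (w₂ γ : 𝕜) * (c₂ * g₂ γ))) ⟨1, hG⟩
      ((g₁.countable_support.union g₂.countable_support).mono fun γ hγ => by
        by_contra hn
        simp only [Set.mem_union, Set.mem_ofPred_eq, not_or, not_not] at hn
        exact hγ (by simp [hn.1, hn.2]))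
    have hsum : mulOp (fun γ => (w γ : 𝕜)) hb g =
        c₁ • mulOp (fun γ => (w₁ γ : 𝕜)) hb₁ g₁ + c₂ • mulOp (fun γ => (w₂ γ : 𝕜)) hb₂ g₂ := by
      ext γ
      simp only [g, mulOp_apply, ofFun_apply, add_apply, smul_apply]
      rcases eq_or_ne (w γ) 0 with h0 | h0
      · have := hle γ
        rw [h0, norm_le_zero_iff] at this
        rw [h0, RCLike.ofReal_zero, zero_mul, ← this]
        ring
      · rw [← mul_assoc, mul_inv_cancel₀ (RCLike.ofReal_ne_zero.2 h0)]
        ring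
    have key : ‖ν (mulOp (fun γ => (w γ : 𝕜)) hb g)‖ ≤ ‖ν ∘L mulOp (fun γ => (w γ : 𝕜)) hb‖ :=
      (ν ∘L mulOp (fun γ => (w γ : 𝕜)) hb).unit_le_opNorm g (norm_le zero_le_one hG)
    rw [hsum, map_add, map_smul, map_smul, smul_eq_mul, smul_eq_mul, ← e₁, ← e₂,
      ← RCLike.ofReal_add, RCLike.norm_of_nonneg (by positivity)] at key
    linarith
  · have : ν ∘L mulOp (fun γ => (w γ : 𝕜)) hb =
        ν ∘L mulOp (fun γ => (w₁ γ : 𝕜)) hb₁ + ν ∘L mulOp (fun γ => (w₂ γ : 𝕜)) hb₂ := by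
      ext x
      simp only [ContinuousLinearMap.comp_apply, _root_.add_apply, ← map_add]
      congr 1
      ext γ
      simp [← h γ, add_mul]
    rw [this]
    exact norm_add_le _ _

section variation
variable (ν : LInftyC 𝕜 Γ →L[𝕜] 𝕜)

/-- The total variation `|ν|(A)` of the functional `ν` on the set `A`, encoded as the norm of `ν`
restricted to the functions supported in `A`. -/
noncomputable def variation (A : Set Γ) : ℝ := ‖ν ∘L proj A‖

lemma variation_nonneg (A : Set Γ) : 0 ≤ variation ν A := norm_nonneg _

lemma norm_comp_proj_mono {Y : Type*} [NormedAddCommGroup Y] [NormedSpace 𝕜 Y]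
    (T : LInftyC 𝕜 Γ →L[𝕜] Y) {A B : Set Γ} (h : A ⊆ B) : ‖T ∘L proj A‖ ≤ ‖T ∘L proj B‖ := by
  refine ContinuousLinearMap.opNorm_le_bound _ (norm_nonneg _) fun x => ?_
  have : proj A x = proj B (proj A x) := by rw [proj_proj, Set.inter_eq_right.2 h]
  rw [ContinuousLinearMap.comp_apply, this]
  exact ((T ∘L proj B).le_opNorm _).trans
    (mul_le_mul_of_nonneg_left (norm_proj_apply_le A x) (norm_nonneg _))

lemma variation_mono {A B : Set Γ} (h : A ⊆ B) : variation ν A ≤ variation ν B :=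
  norm_comp_proj_mono ν h

lemma variation_le_norm (A : Set Γ) : variation ν A ≤ ‖ν‖ :=
  ContinuousLinearMap.opNorm_le_bound _ (norm_nonneg _) fun x =>
    (ν.le_opNorm _).trans (mul_le_mul_of_nonneg_left (norm_proj_apply_le A x) (norm_nonneg _))

lemma norm_apply_proj_le (A : Set Γ) (x : LInftyC 𝕜 Γ) : ‖ν (proj A x)‖ ≤ variation ν A * ‖x‖ :=
  (ν ∘L proj A).le_opNorm x

lemma norm_apply_single_le (γ : Γ) : ‖ν (single γ)‖ ≤ variation ν {γ} := by
  have := norm_apply_proj_le ν {γ} (single γ)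
  rw [proj_single] at this
  exact this.trans (mul_le_of_le_one_right (norm_nonneg _) (norm_single_le γ))

lemma variation_union {A B : Set Γ} (h : Disjoint A B) :
    variation ν A + variation ν B = variation ν (A ∪ B) := by
  classical
  have hb : ∀ C : Set Γ, ∃ c, ∀ γ, ‖((C.indicator 1 γ : ℝ) : 𝕜)‖ ≤ c := fun C =>
    ⟨1, fun γ => by by_cases h : γ ∈ C <;> simp [h]⟩
  have hC : ∀ C : Set Γ, variation ν C =
      ‖ν ∘L mulOp (fun γ => ((C.indicator 1 γ : ℝ) : 𝕜)) (hb C)‖ :=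
    fun C => by
      rw [variation]
      congr 2
      ext x γ
      by_cases h : γ ∈ C <;> simp [proj, h]
  rw [hC, hC, hC]
  refine norm_comp_mulOp_add ν _ _ _ (fun γ => Set.indicator_nonneg (by simp) γ)
    (fun γ => Set.indicator_nonneg (by simp) γ) (fun γ => ?_) _ _ _
  rw [Set.indicator_union_of_disjoint h]

lemma variation_union_le (A B : Set Γ) : variation ν (A ∪ B) ≤ variation ν A + variation ν B := by
  rw [← Set.union_sdiff_self, ← variation_union ν Set.disjoint_sdiff_right]
  gcongr
  exact variation_mono ν Set.sdiff_subset

lemma sum_norm_apply_single_le (s : Finset Γ) : ∑ γ ∈ s, ‖ν (single γ)‖ ≤ variation ν s := by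
  classical
  induction s using Finset.induction_on with
  | empty => simpa using variation_nonneg ν ∅
  | insert a s ha ih =>
    rw [Finset.sum_insert ha, Finset.coe_insert, Set.insert_eq,
      ← variation_union ν (Set.disjoint_singleton_left.2 (by simpa using ha))]
    exact add_le_add (norm_apply_single_le ν a) ih

/-- A functional on `ℓ_∞^c(Γ)` is large at only finitely many unit vectors, since its restriction to
`c₀(Γ)` is summable. -/
lemma finite_setOf_lt_norm_apply_single {δ : ℝ} (hδ : 0 < δ) :
    {γ | δ < ‖ν (single γ)‖}.Finite := by
  by_contra hinf
  obtain ⟨n, hn⟩ := exists_nat_gt (‖ν‖ / δ)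
  obtain ⟨s, hs, hcard⟩ := Set.Infinite.exists_subset_card_eq hinf n
  have h1 : (n : ℝ) * δ ≤ ∑ γ ∈ s, ‖ν (single γ)‖ := by
    rw [← hcard, ← nsmul_eq_mul]
    exact Finset.card_nsmul_le_sum _ _ _ fun γ hγ => (hs hγ).le
  have h2 := h1.trans ((sum_norm_apply_single_le ν s).trans (variation_le_norm ν _))
  rw [div_lt_iff₀ hδ] at hn
  linarith

end variation

end LInftyC

/-! ### Rosenthal's lemma and factorizations of the identity -/

namespace LInftyC

variable {𝕜 : Type v} [RCLike 𝕜] {Γ I Λ : Type*}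

/-- Rosenthal's lemma for an infinite index set of arbitrary cardinality: a bounded family of
functionals has a subfamily, of the same size, each member of which has small variation off the
diagonal. If no block of a partition of `I` into `#I` blocks of size `#I` works, then a transversal
of the partition lowers the variations of its own members by `ε`; this can happen only finitely many
times. -/
lemma exists_injective_variation_le [Infinite I] (ν : I → LInftyC 𝕜 I →L[𝕜] 𝕜) {M : ℝ}
    (hM : ∀ i, ‖ν i‖ ≤ M) {ε : ℝ} (hε : 0 < ε) :
    ∃ j : I → I, Function.Injective j ∧
      ∀ i, variation (ν (j i)) (Set.range j \ {j i}) ≤ ε := by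
  obtain ⟨e⟩ : Nonempty (I × I ≃ I) := Cardinal.eq.1 (by simp)
  have key : ∀ (n : ℕ) (s : I → I), Function.Injective s →
      (∀ i, variation (ν (s i)) (Set.range s) ≤ n * ε) →
      ∃ j : I → I, Function.Injective j ∧
        ∀ i, variation (ν (j i)) (Set.range j \ {j i}) ≤ ε := by
    intro n
    induction n with
    | zero =>
      refine fun s hs h => ⟨s, hs, fun i => ?_⟩
      refine (variation_mono (ν (s i)) Set.sdiff_subset).trans ((h i).trans ?_)
      simpa using hε.le
    | succ n ih =>
      intro s hs h
      by_cases hblock : ∃ i, ∀ k, variation (ν (s (e (i, k))))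
          (Set.range (fun k => s (e (i, k))) \ {s (e (i, k))}) ≤ ε
      · obtain ⟨i, hi⟩ := hblock
        exact ⟨fun k => s (e (i, k)), fun k l hkl => by simpa using e.injective (hs hkl), hi⟩
      · push Not at hblock
        choose k hk using hblock
        refine ih (fun i => s (e (i, k i))) (fun i l hil => by
          have := e.injective (hs hil)
          simp only [Prod.mk.injEq] at this
          exact this.1) fun i => ?_
        have hdisj : Disjoint (Set.range fun i => s (e (i, k i)))
            (Set.range (fun k => s (e (i, k))) \ {s (e (i, k i))}) := by
          rw [Set.disjoint_left]
          rintro _ ⟨l, rfl⟩ ⟨⟨m, hm⟩, hne⟩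
          have := e.injective (hs hm)
          simp only [Prod.mk.injEq] at this
          obtain ⟨rfl, rfl⟩ := this
          exact hne rfl
        have h1 := variation_union (ν (s (e (i, k i)))) hdisj
        have h2 : variation (ν (s (e (i, k i)))) ((Set.range fun i => s (e (i, k i))) ∪
            (Set.range (fun k => s (e (i, k))) \ {s (e (i, k i))})) ≤ (n + 1 : ℕ) * ε := by
          refine (variation_mono _ ?_).trans (h _)
          rintro _ (⟨l, rfl⟩ | ⟨⟨l, rfl⟩, -⟩) <;> exact ⟨_, rfl⟩
        push_cast at h2
        linarith [hk i]
  obtain ⟨n, hn⟩ := exists_nat_ge (M / ε)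
  refine key n id Function.injective_id fun i => (variation_le_norm _ _).trans ((hM i).trans ?_)
  rwa [div_le_iff₀ hε] at hn

/-- An operator that is bounded away from zero on the unit vectors of `ℓ_∞^c(I)` factors the
identity. By Rosenthal's lemma, after passing to a subset of `I`, the coordinate functionals at
which the images of the unit vectors are large form an approximate left inverse. -/
theorem exists_comp_comp_eq_id_of_lt_norm_single [Infinite I]
    (V : LInftyC 𝕜 I →L[𝕜] LInftyC 𝕜 Λ) {δ : ℝ} (hδ : 0 < δ) (hV : ∀ i, δ < ‖V (single i)‖) :
    ∃ (A : LInftyC 𝕜 I →L[𝕜] LInftyC 𝕜 I) (B : LInftyC 𝕜 Λ →L[𝕜] LInftyC 𝕜 I),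
      B ∘L V ∘L A = ContinuousLinearMap.id 𝕜 _ := by
  classical
  choose γ hγ using fun i => exists_lt_norm_apply hδ.le (hV i)
  let ν : I → LInftyC 𝕜 I →L[𝕜] 𝕜 := fun i => coord (γ i) ∘L V
  have hν : ∀ i, ‖ν i‖ ≤ ‖V‖ := fun i =>
    (ContinuousLinearMap.opNorm_comp_le _ _).trans
      (mul_le_of_le_one_left (norm_nonneg _) (norm_coord_le _))
  obtain ⟨j, hj, hvar⟩ := exists_injective_variation_le ν hν (half_pos hδ)
  let A : LInftyC 𝕜 I →L[𝕜] LInftyC 𝕜 I := weightedComp (Function.invFun j)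
    ((Set.range j).indicator 1) ⟨1, fun k => by by_cases h : k ∈ Set.range j <;> simp [h]⟩
    fun i => (Set.countable_singleton (j i)).mono fun k ⟨h1, h2⟩ => by
      have hk : k ∈ Set.range j := Set.mem_of_indicator_ne_zero h2
      rw [Set.mem_singleton_iff, ← h1, Function.invFun_eq hk]
  have hw : ∀ i, ‖(ν (j i) (single (j i)))⁻¹‖ ≤ δ⁻¹ := fun i => by
    rw [norm_inv]
    exact inv_anti₀ hδ (hγ (j i)).le
  let B : LInftyC 𝕜 Λ →L[𝕜] LInftyC 𝕜 I := weightedComp (fun i => γ (j i))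
    (fun i => (ν (j i) (single (j i)))⁻¹) ⟨_, hw⟩ fun g => by
      refine Set.Countable.mono (fun i hi => ?_)
        ((finite_setOf_lt_norm_apply_single (coord g ∘L V) hδ).countable.preimage_of_injOn
          (f := j) hj.injOn)
      have := hγ (j i)
      rw [hi.1] at this
      exact this
  have hclose : ‖1 - B ∘L V ∘L A‖ ≤ 1 / 2 := by
    refine ContinuousLinearMap.opNorm_le_bound _ (by norm_num) fun x =>
      norm_le (by positivity) fun i => ?_
    have hAx : A x = x i • single (j i) + proj (Set.range j \ {j i}) (A x) := by
      ext k
      rw [add_apply, smul_apply]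
      rcases eq_or_ne k (j i) with rfl | hk
      · rw [proj_apply_of_notMem (by simp), single_apply_self]
        simp [A, Function.leftInverse_invFun hj i]
      · rw [single_apply_of_ne hk]
        by_cases hkr : k ∈ Set.range j
        · rw [proj_apply_of_mem (show k ∈ Set.range j \ {j i} from ⟨hkr, hk⟩), mul_zero, zero_add]
        · rw [proj_apply_of_notMem (fun h => hkr h.1)]
          simp [A, hkr]
    have hAnorm : ‖A x‖ ≤ ‖x‖ := norm_le (norm_nonneg _) fun k => by
      by_cases hkr : k ∈ Set.range j
      · simpa only [A, weightedComp_apply, Set.indicator_of_mem hkr, Pi.one_apply, one_mul]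
          using norm_apply_le x _
      · simp only [A, weightedComp_apply, Set.indicator_of_notMem hkr, zero_mul, norm_zero,
          norm_nonneg]
    have hne : ν (j i) (single (j i)) ≠ 0 := norm_pos_iff.1 (hδ.trans (hγ (j i)))
    have hval : (1 - B ∘L V ∘L A) x i =
        -((ν (j i) (single (j i)))⁻¹ * ν (j i) (proj (Set.range j \ {j i}) (A x))) := by
      have h1 : (1 - B ∘L V ∘L A) x i = x i - (ν (j i) (single (j i)))⁻¹ * ν (j i) (A x) := rfl
      have h2 : ν (j i) (A x) = x i * ν (j i) (single (j i)) +
          ν (j i) (proj (Set.range j \ {j i}) (A x)) := by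
        conv_lhs => rw [hAx, map_add, map_smul, smul_eq_mul]
      rw [h1, h2]
      field_simp
      ring
    rw [hval, norm_neg, norm_mul]
    calc _ ≤ δ⁻¹ * (δ / 2 * ‖x‖) := by
          refine mul_le_mul (hw i) ((norm_apply_proj_le _ _ _).trans ?_) (norm_nonneg _)
            (by positivity)
          exact mul_le_mul (hvar i) hAnorm (norm_nonneg _) (by positivity)
      _ = 1 / 2 * ‖x‖ := by field_simp
  let U := Units.oneSub (1 - B ∘L V ∘L A) (hclose.trans_lt (by norm_num))
  refine ⟨A, (↑U⁻¹ : LInftyC 𝕜 I →L[𝕜] LInftyC 𝕜 I) ∘L B, ?_⟩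
  have hU : (U : LInftyC 𝕜 I →L[𝕜] LInftyC 𝕜 I) = B ∘L V ∘L A := by simp [U]
  rw [ContinuousLinearMap.comp_assoc, ← hU]
  exact U.inv_mul

/-- If an operator has norm larger than `δ` on each of the bands of a disjoint family of sets
indexed by `I`, it factors the identity of `ℓ_∞^c(I)`. -/
theorem exists_comp_comp_eq_id_of_lt_norm_comp_proj [Infinite I]
    (T : LInftyC 𝕜 Γ →L[𝕜] LInftyC 𝕜 Λ) {δ : ℝ} (hδ : 0 < δ) (S : I → Set Γ)
    (hS : Pairwise (Function.onFun Disjoint S)) (hT : ∀ i, δ < ‖T ∘L proj (S i)‖) :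
    ∃ (A : LInftyC 𝕜 I →L[𝕜] LInftyC 𝕜 Γ) (B : LInftyC 𝕜 Λ →L[𝕜] LInftyC 𝕜 I),
      B ∘L T ∘L A = ContinuousLinearMap.id 𝕜 _ := by
  classical
  choose g hg hTg using fun i => exists_lt_norm_apply_of_lt_opNorm _ (hT i)
  have hφ : ∀ γ, ∃ i, ∀ k, γ ∈ S k → k = i := fun γ => by
    by_cases h : ∃ i, γ ∈ S i
    · obtain ⟨i, hi⟩ := h
      exact ⟨i, fun k hk => by_contra fun hne => Set.disjoint_left.1 (hS hne) hk hi⟩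
    · exact ⟨Classical.arbitrary I, fun k hk => absurd ⟨k, hk⟩ h⟩
  choose φ hφ using hφ
  let G : LInftyC 𝕜 I →L[𝕜] LInftyC 𝕜 Γ := weightedComp φ (fun γ => proj (S (φ γ)) (g (φ γ)) γ)
    ⟨1, fun γ => (norm_apply_le _ _).trans ((norm_proj_apply_le _ _).trans (hg _))⟩
    fun i => (proj (S i) (g i)).countable_support.mono fun γ hγ => by
      obtain ⟨rfl, h⟩ := hγ
      exact h
  have hG : ∀ i, G (single i) = proj (S i) (g i) := fun i => by
    ext γ
    rw [weightedComp_apply]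
    rcases eq_or_ne (φ γ) i with rfl | h
    · rw [single_apply_self, mul_one]
    · rw [single_apply_of_ne h, mul_zero, proj_apply_of_notMem fun hi => h (hφ γ i hi).symm]
  obtain ⟨A, B, h⟩ := exists_comp_comp_eq_id_of_lt_norm_single (T ∘L G) hδ fun i => by
    rw [ContinuousLinearMap.comp_apply, hG]
    exact hTg i
  exact ⟨G ∘L A, B, h⟩

lemma isBoundedBelowOnCopyOf_of_comp_comp_eq_id {E X Y : Type*} [NormedAddCommGroup E]
    [NormedSpace 𝕜 E] [NormedAddCommGroup X] [NormedSpace 𝕜 X] [NormedAddCommGroup Y]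
    [NormedSpace 𝕜 Y] (T : X →L[𝕜] Y) (A : E →L[𝕜] X) (B : Y →L[𝕜] E)
    (h : B ∘L T ∘L A = ContinuousLinearMap.id 𝕜 E) : IsBoundedBelowOnCopyOf E T := by
  have hx : ∀ x, B (T (A x)) = x := fun x => DFunLike.congr_fun h x
  refine ⟨LinearMap.range (A : E →ₗ[𝕜] X), ⟨ContinuousLinearEquiv.equivOfInverse
    (A.codRestrict _ fun x => LinearMap.mem_range_self (A : E →ₗ[𝕜] X) x)
    ((B ∘L T) ∘L Submodule.subtypeL _) (fun x => hx x) ?_⟩, (‖A‖ * ‖B‖ + 1)⁻¹, by positivity, ?_⟩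
  · rintro ⟨_, x, rfl⟩
    exact Subtype.ext (congrArg A (hx x))
  · rintro _ ⟨x, rfl⟩
    rw [inv_mul_le_iff₀ (by positivity)]
    calc ‖A x‖ ≤ ‖A‖ * ‖x‖ := A.le_opNorm x
      _ = ‖A‖ * ‖B (T (A x))‖ := by rw [hx]
      _ ≤ ‖A‖ * (‖B‖ * ‖T (A x)‖) := by gcongr; exact B.le_opNorm _
      _ ≤ (‖A‖ * ‖B‖ + 1) * ‖T (A x)‖ := by nlinarith [norm_nonneg (T (A x))]

lemma exists_lt_norm_apply_single_of_isBoundedBelowOnCopyOf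
    {T : LInftyC 𝕜 Γ →L[𝕜] LInftyC 𝕜 Λ} (h : IsBoundedBelowOnCopyOf (LInftyC 𝕜 I) T) :
    ∃ (U : LInftyC 𝕜 I →L[𝕜] LInftyC 𝕜 Γ) (δ : ℝ), 0 < δ ∧ ∀ i, δ < ‖T (U (single i))‖ := by
  obtain ⟨E₀, ⟨e⟩, c, hc, hcT⟩ := h
  set K := ‖(e.symm : E₀ →L[𝕜] LInftyC 𝕜 I)‖ with hK
  refine ⟨E₀.subtypeL ∘L (e : LInftyC 𝕜 I →L[𝕜] E₀), c * (K + 1)⁻¹, by positivity, fun i => ?_⟩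
  have h1 : (1 : ℝ) ≤ K * ‖e (single i)‖ :=
    calc (1 : ℝ) = ‖(single i : LInftyC 𝕜 I) i‖ := by simp
      _ ≤ ‖(single i : LInftyC 𝕜 I)‖ := norm_apply_le _ _
      _ = ‖(e.symm : E₀ →L[𝕜] LInftyC 𝕜 I) (e (single i))‖ := by simp
      _ ≤ _ := ContinuousLinearMap.le_opNorm _ _
  have h2 : 0 < ‖e (single i)‖ := by
    by_contra h0
    rw [le_antisymm (not_lt.1 h0) (norm_nonneg _), mul_zero] at h1
    exact absurd h1 (by norm_num)
  refine lt_of_lt_of_le ?_ (hcT (e (single i)) (e (single i)).2)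
  refine mul_lt_mul_of_pos_left ?_ hc
  rw [inv_lt_iff_one_lt_mul₀ (by positivity)]
  change 1 < ‖e (single i)‖ * (K + 1)
  linarith

/-- Between spaces of bounded functions with countable support, an operator that fixes a copy of
`ℓ_∞^c(I)` factors the identity of `ℓ_∞^c(I)`. -/
theorem exists_comp_comp_eq_id_of_isBoundedBelowOnCopyOf [Infinite I]
    {T : LInftyC 𝕜 Γ →L[𝕜] LInftyC 𝕜 Λ} (h : IsBoundedBelowOnCopyOf (LInftyC 𝕜 I) T) :
    ∃ (A : LInftyC 𝕜 I →L[𝕜] LInftyC 𝕜 Γ) (B : LInftyC 𝕜 Λ →L[𝕜] LInftyC 𝕜 I),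
      B ∘L T ∘L A = ContinuousLinearMap.id 𝕜 _ := by
  obtain ⟨U, δ, hδ, hU⟩ := exists_lt_norm_apply_single_of_isBoundedBelowOnCopyOf h
  obtain ⟨A, B, hAB⟩ := exists_comp_comp_eq_id_of_lt_norm_single (T ∘L U) hδ hU
  exact ⟨U ∘L A, B, hAB⟩

/-- `ℓ_∞^c(I)` does not embed into `ℓ_∞^c(Λ)` when `I` is larger than the infinite set `Λ`: each
of the coordinate functionals sees only finitely many unit vectors. -/
theorem not_isBoundedBelowOnCopyOf_of_mk_lt {I Γ Λ : Type u} [Infinite Λ] (h : #Λ < #I)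
    (T : LInftyC 𝕜 Γ →L[𝕜] LInftyC 𝕜 Λ) : ¬ IsBoundedBelowOnCopyOf (LInftyC 𝕜 I) T := by
  intro hT
  obtain ⟨U, δ, hδ, hU⟩ := exists_lt_norm_apply_single_of_isBoundedBelowOnCopyOf hT
  have huniv : (Set.univ : Set I) ⊆
      ⋃ g : Λ, {i | δ < ‖(coord g ∘L T ∘L U) (single i)‖} := fun i _ =>
    Set.mem_iUnion.2 (exists_lt_norm_apply hδ.le (hU i))
  refine h.not_ge ?_
  calc #I = #(Set.univ : Set I) := Cardinal.mk_univ.symm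
    _ ≤ #(⋃ g : Λ, {i | δ < ‖(coord g ∘L T ∘L U) (single i)‖}) := Cardinal.mk_le_mk_of_subset huniv
    _ ≤ #Λ * ⨆ g : Λ, #{i | δ < ‖(coord g ∘L T ∘L U) (single i)‖} := Cardinal.mk_iUnion_le _
    _ ≤ #Λ * ℵ₀ := by
        gcongr
        exact ciSup_le' fun g => ((finite_setOf_lt_norm_apply_single _ hδ).lt_aleph0).le
    _ = #Λ := Cardinal.mul_aleph0_eq (Cardinal.aleph0_le_mk Λ)

end LInftyC

/-! ### A criterion for weak compactness -/

section WeakCompactness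

open Filter Topology

/-- In a regular space it suffices to test relative compactness on the ultrafilters that contain the
set itself rather than its closure. -/
lemma isCompact_closure_of_ultrafilter {Z : Type*} [TopologicalSpace Z] [RegularSpace Z]
    {S : Set Z} (h : ∀ U : Ultrafilter Z, S ∈ U → ∃ z, (U : Filter Z) ≤ 𝓝 z) :
    IsCompact (closure S) := by
  rw [isCompact_iff_ultrafilter_le_nhds]
  intro V hV
  have hVS : closure S ∈ V := le_principal_iff.1 hV
  have hne : ((V : Filter Z).bind 𝓝 ⊓ 𝓟 S).NeBot := by
    rw [inf_principal_neBot_iff]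
    intro A hA
    obtain ⟨z, hz, hzS⟩ := V.nonempty_of_mem (inter_mem (mem_bind'.1 hA) hVS)
    exact mem_closure_iff_nhds.1 hzS A hz
  have hU := Ultrafilter.of_le ((V : Filter Z).bind 𝓝 ⊓ 𝓟 S)
  set U := Ultrafilter.of ((V : Filter Z).bind 𝓝 ⊓ 𝓟 S)
  obtain ⟨z, hz⟩ := h U (hU (mem_inf_of_right (mem_principal_self S)))
  have hVz : (V : Filter Z) ≤ 𝓝 z := by
    refine (closed_nhds_basis z).ge_iff.2 fun N ⟨hN, hNc⟩ => ?_
    by_contra hNV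
    have h1 : Nᶜ ∈ V := Ultrafilter.compl_mem_iff_notMem.2 hNV
    have h2 : Nᶜ ∈ U := hU (mem_inf_of_left (mem_bind'.2 (mem_of_superset h1 fun x hx =>
      hNc.isOpen_compl.mem_nhds hx)))
    exact Ultrafilter.compl_mem_iff_notMem.1 h2 (hz hN)
  exact ⟨z, isClosed_closure.mem_of_tendsto (f := id) (b := (V : Filter Z)) hVz hVS, hVz⟩

variable {𝕜 : Type v} [RCLike 𝕜] {X Y : Type*} [NormedAddCommGroup X] [NormedSpace 𝕜 X]
  [NormedAddCommGroup Y] [NormedSpace 𝕜 Y]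

/-- Suppose that `T x` is small whenever `x` is in the unit ball and `q x` is small, where `q ≥ 0`
satisfies the parallelogram law. Then the values of `T` along an ultrafilter on the unit ball have
an approximate weak limit. Near-minimizers of `q` in the midpoint-convex members of the
ultrafilter are `q`-close to each other, so their images under `T` are close in norm. -/
lemma exists_approx_weak_limit (T : X →L[𝕜] Y) {ε δ C : ℝ} (hδ : 0 < δ) (q : X → ℝ)
    (hq0 : ∀ x, 0 ≤ q x) (hqC : ∀ x, ‖x‖ ≤ 1 → q x ≤ C)
    (hq : ∀ x y, q (x + y) + q (x - y) = 2 * q x + 2 * q y)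
    (hT : ∀ x, ‖x‖ ≤ 1 → q x < δ → ‖T x‖ ≤ ε)
    (U : Ultrafilter X) (hU : Metric.closedBall (0 : X) 1 ∈ U) :
    ∃ y : Y, ∀ (h : Y →L[𝕜] 𝕜) (l : 𝕜), Tendsto (fun x => h (T x)) U (𝓝 l) →
      ‖l - h y‖ ≤ 2 * ε * ‖h‖ := by
  let 𝒞 : Set (Set X) := {D | D ∈ U ∧ D ⊆ Metric.closedBall (0 : X) 1 ∧
    ∀ x ∈ D, ∀ y ∈ D, (2⁻¹ : 𝕜) • (x + y) ∈ D}
  have half_norm : ∀ x y : X, ‖x‖ ≤ 1 → ‖y‖ ≤ 1 → ‖(2⁻¹ : 𝕜) • (x + y)‖ ≤ 1 := fun x y hx hy => by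
    rw [norm_smul, norm_inv, RCLike.norm_ofNat]
    linarith [norm_add_le x y]
  have hball : Metric.closedBall (0 : X) 1 ∈ 𝒞 := by
    refine ⟨hU, subset_rfl, fun x hx y hy => ?_⟩
    rw [mem_closedBall_zero_iff] at *
    exact half_norm x y hx hy
  have hne : ∀ D ∈ 𝒞, (q '' D).Nonempty := fun D hD => (U.nonempty_of_mem hD.1).image q
  have hbelow : ∀ D : Set X, BddBelow (q '' D) := fun D => ⟨0, by
    rintro _ ⟨x, -, rfl⟩
    exact hq0 x⟩
  have habove : BddAbove ((fun D => sInf (q '' D)) '' 𝒞) := ⟨C, by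
    rintro _ ⟨D, hD, rfl⟩
    obtain ⟨x, hx⟩ := U.nonempty_of_mem hD.1
    exact (csInf_le (hbelow D) ⟨x, hx, rfl⟩).trans
      (hqC x (by simpa using hD.2.1 hx))⟩
  set d := sSup ((fun D => sInf (q '' D)) '' 𝒞)
  have hle : ∀ D ∈ 𝒞, sInf (q '' D) ≤ d := fun D hD => le_csSup habove ⟨D, hD, rfl⟩
  have near : ∀ D ∈ 𝒞, ∃ x ∈ D, q x < d + δ / 2 := fun D hD => by
    obtain ⟨_, ⟨x, hx, rfl⟩, hlt⟩ := exists_lt_of_csInf_lt (hne D hD)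
      (show sInf (q '' D) < d + δ / 2 by linarith [hle D hD])
    exact ⟨x, hx, hlt⟩
  obtain ⟨_, ⟨D, hD, rfl⟩, hDd⟩ := exists_lt_of_lt_csSup (⟨_, _, hball, rfl⟩ :
    ((fun D => sInf (q '' D)) '' 𝒞).Nonempty) (show d - δ / 2 < d by linarith)
  obtain ⟨f, hf, hfd⟩ := near D hD
  refine ⟨T f, fun h l hl => le_of_forall_pos_le_add fun r hr => ?_⟩
  have hD' : D ∩ {x | ‖h (T x) - l‖ ≤ r} ∈ 𝒞 := by
    refine ⟨inter_mem hD.1 ?_, Set.inter_subset_left.trans hD.2.1, fun x hx y hy =>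
      ⟨hD.2.2 x hx.1 y hy.1, ?_⟩⟩
    · filter_upwards [hl (Metric.closedBall_mem_nhds l hr)] with x hx
      simpa [dist_eq_norm] using hx
    · have h1 : ‖h (T x) - l‖ ≤ r := hx.2
      have h2 : ‖h (T y) - l‖ ≤ r := hy.2
      have h3 : h (T ((2⁻¹ : 𝕜) • (x + y))) - l =
          (2⁻¹ : 𝕜) * ((h (T x) - l) + (h (T y) - l)) := by
        simp only [map_smul, map_add, smul_eq_mul]
        ring
      rw [Set.mem_ofPred_eq, h3, norm_mul, norm_inv, RCLike.norm_ofNat]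
      linarith [norm_add_le (h (T x) - l) (h (T y) - l)]
  obtain ⟨g, ⟨hgD, hgl⟩, hgd⟩ := near _ hD'
  have hgl : ‖h (T g) - l‖ ≤ r := hgl
  set u := (2⁻¹ : 𝕜) • (f + g) with hu
  set w := (2⁻¹ : 𝕜) • (f + -g) with hw
  have e1 : u + w = f := by
    rw [hu, hw, ← smul_add, show f + g + (f + -g) = (2 : 𝕜) • f by rw [two_smul]; abel,
      inv_smul_smul₀ two_ne_zero]
  have e2 : u - w = g := by
    rw [hu, hw, ← smul_sub, show f + g - (f + -g) = (2 : 𝕜) • g by rw [two_smul]; abel,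
      inv_smul_smul₀ two_ne_zero]
  have hqu : d - δ / 2 < q u :=
    hDd.trans_le (csInf_le (hbelow D) ⟨u, hD.2.2 f hf g hgD, rfl⟩)
  have hqw : q w < δ := by
    have := hq u w
    rw [e1, e2] at this
    linarith
  have hTw : ‖T w‖ ≤ ε := hT w (half_norm _ _ (by simpa using hD.2.1 hf)
    (by simpa using hD.2.1 hgD)) hqw
  have e3 : l - h (T f) = -(h (T g) - l) - 2 * h (T w) := by
    rw [← e1, ← e2]
    simp only [map_add, map_sub]
    ring
  have h4 : ‖h (T w)‖ ≤ ‖h‖ * ε := (h.le_opNorm _).trans (by gcongr)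
  calc ‖l - h (T f)‖ ≤ ‖h (T g) - l‖ + 2 * ‖h (T w)‖ := by
        rw [e3]
        refine (norm_sub_le _ _).trans ?_
        rw [norm_neg, norm_mul, RCLike.norm_ofNat]
    _ ≤ 2 * ε * ‖h‖ + r := by linarith

/-- An operator into a Banach space is weakly compact if, for every `ε`, it is `ε`-small on the
unit vectors that are small with respect to some nonnegative function satisfying the parallelogram
law. -/
theorem isWeaklyCompactOperator_of_parallelogram [CompleteSpace Y] (T : X →L[𝕜] Y)
    (hT : ∀ ε > 0, ∃ q : X → ℝ, (∀ x, 0 ≤ q x) ∧ (∃ C, ∀ x, ‖x‖ ≤ 1 → q x ≤ C) ∧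
      (∀ x y, q (x + y) + q (x - y) = 2 * q x + 2 * q y) ∧
      ∃ δ > 0, ∀ x, ‖x‖ ≤ 1 → q x < δ → ‖T x‖ ≤ ε) :
    IsWeaklyCompactOperator T := by
  refine isCompact_closure_of_ultrafilter fun V hV => ?_
  -- lift the ultrafilter on the image of the unit ball to an ultrafilter on the unit ball
  obtain ⟨U, hU, hUV⟩ : ∃ U : Ultrafilter X, Metric.closedBall (0 : X) 1 ∈ U ∧
      U.map (fun x => toWeakSpace 𝕜 Y (T x)) = V := by
    rw [Set.image_image] at hV
    exact ⟨Ultrafilter.ofComapInfPrincipal hV, Ultrafilter.ofComapInfPrincipal_mem hV,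
      Ultrafilter.ofComapInfPrincipal_eq_of_map hV⟩
  have hlim : ∀ h : Y →L[𝕜] 𝕜, ∃ l, Tendsto (fun x => h (T x)) U (𝓝 l) := fun h => by
    have hK : IsCompact (Metric.closedBall (0 : 𝕜) (‖h ∘L T‖)) := isCompact_closedBall _ _
    obtain ⟨l, -, hl⟩ := hK.ultrafilter_le_nhds (U.map fun x => h (T x))
      (le_principal_iff.2 (Ultrafilter.mem_map.2 (mem_of_superset hU fun x hx => by
        rw [Set.mem_preimage, mem_closedBall_zero_iff]
        exact (h ∘L T).unit_le_opNorm x (by simpa using hx))))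
    exact ⟨l, hl⟩
  choose l hl using hlim
  have happrox : ∀ n : ℕ, ∃ y : Y, ∀ h : Y →L[𝕜] 𝕜, ‖l h - h y‖ ≤ 2 * (1 / ((n : ℝ) + 1)) * ‖h‖ :=
    fun n => by
      obtain ⟨q, hq0, ⟨C, hqC⟩, hq, δ, hδ, hqT⟩ := hT (1 / ((n : ℝ) + 1)) (by positivity)
      obtain ⟨y, hy⟩ := exists_approx_weak_limit T hδ q hq0 hqC hq hqT U hU
      exact ⟨y, fun h => hy h (l h) (hl h)⟩
  choose y hy using happrox
  have hb : Tendsto (fun n : ℕ => 2 * (1 / ((n : ℝ) + 1))) atTop (𝓝 0) := by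
    simpa using tendsto_one_div_add_atTop_nhds_zero_nat.const_mul (2 : ℝ)
  have hcauchy : CauchySeq y := by
    refine cauchySeq_of_le_tendsto_0 (fun n : ℕ => 2 * (2 * (1 / ((n : ℝ) + 1)))) ?_
      (by simpa using hb.const_mul (2 : ℝ))
    intro n m N hn hm
    rw [dist_eq_norm]
    refine NormedSpace.norm_le_dual_bound 𝕜 _ (by positivity) fun h => ?_
    have mono : ∀ k : ℕ, N ≤ k → 2 * (1 / ((k : ℝ) + 1)) * ‖h‖ ≤ 2 * (1 / ((N : ℝ) + 1)) * ‖h‖ :=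
      fun k hk => by gcongr
    have e : h (y n - y m) = (l h - h (y m)) - (l h - h (y n)) := by rw [map_sub]; ring
    rw [e]
    refine (norm_sub_le _ _).trans ?_
    linarith [hy n h, hy m h, mono n hn, mono m hm]
  obtain ⟨z, hz⟩ := cauchySeq_tendsto_of_complete hcauchy
  have hlz : ∀ h : Y →L[𝕜] 𝕜, l h = h z := fun h => by
    have h1 : Tendsto (fun n => ‖l h - h (y n)‖) atTop (𝓝 ‖l h - h z‖) :=
      (((h.continuous.tendsto z).comp hz).const_sub (l h)).norm
    have h2 : ‖l h - h z‖ ≤ 0 * ‖h‖ :=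
      le_of_tendsto_of_tendsto' h1 (hb.mul_const ‖h‖) fun n => hy n h
    rw [zero_mul, norm_le_zero_iff, sub_eq_zero] at h2
    exact h2
  refine ⟨toWeakSpace 𝕜 Y z, ?_⟩
  rw [← hUV]
  change Tendsto (fun x => toWeakSpace 𝕜 Y (T x)) U (𝓝 (toWeakSpace 𝕜 Y z))
  refine (WeakBilin.tendsto_iff_forall_eval_tendsto (topDualPairing 𝕜 Y).flip ?_).2 fun h => ?_
  · intro a b hab
    refine eq_of_sub_eq_zero (SeparatingDual.eq_zero_of_forall_dual_eq_zero (R := 𝕜) fun h => ?_)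
    have : h a = h b := DFunLike.congr_fun hab h
    simpa [sub_eq_zero] using this
  · have := hl h
    rw [hlz h] at this
    exact this

end WeakCompactness

/-! ### Exhaustive set functions -/

section SetFunction

variable {Γ : Type*} {η : Set Γ → ℝ}

/-- If `η` is small on the members of every disjoint sequence, it is small on the successive
differences of an increasing sequence of sets, from some index on. -/
lemma exists_forall_ge_apply_sdiff_le
    (hη : ∀ c > 0, ∀ B : ℕ → Set Γ, Pairwise (Function.onFun Disjoint B) → ∃ k, η (B k) ≤ c)
    {U : ℕ → Set Γ} (hU : Monotone U) {ε : ℝ} (hε : 0 < ε) :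
    ∃ n, ∀ m ≥ n, η (U m \ U n) ≤ ε := by
  by_contra! h
  choose m hm hlt using h
  let s : ℕ → ℕ := fun k => m^[k] 0
  have hs : ∀ k, s (k + 1) = m (s k) := fun k => Function.iterate_succ_apply' m k 0
  have hmono : Monotone s := monotone_nat_of_le_succ fun k => (hs k).symm ▸ hm (s k)
  obtain ⟨k, hk⟩ := hη ε hε (fun k => U (s (k + 1)) \ U (s k)) <| by
    refine (pairwise_disjoint_on _).2 fun i j hij => ?_
    exact Set.disjoint_left.2 fun γ hi hj => hj.2 (hU (hmono (Nat.succ_le_of_lt hij)) hi.1)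
  exact absurd hk (not_le.2 (hs k ▸ hlt (s k)))

lemma apply_biUnion_le_sum {m : Set Γ → ℝ} (h0 : m ∅ ≤ 0)
    (hsub : ∀ A B, m (A ∪ B) ≤ m A + m B) {ι : Type*} (s : Finset ι) (A : ι → Set Γ) :
    m (⋃ j ∈ s, A j) ≤ ∑ j ∈ s, m (A j) := by
  classical
  induction s using Finset.induction_on with
  | empty => simpa using h0
  | insert a s ha ih =>
    rw [Finset.sum_insert ha, Finset.set_biUnion_insert]
    exact (hsub _ _).trans (by gcongr)

/-- Let subadditive monotone set functions `m k` be dominated by `η`, and suppose that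
`m k (A k) ≥ c` for all `k`, while `m i (A k)` is at most `2⁻ᵏ` for `i < k`. Then `η` is not small
along all disjoint sequences. With only finite additivity the sets `A k` cannot be made disjoint by
removing the infinite union of their successors; instead they are replaced by a decreasing sequence
`G k`, intersections of finite unions that almost exhaust the tails `A j ∪ A (j + 1) ∪ ⋯`. -/
lemma exists_disjoint_lt_of_dominated {m : ℕ → Set Γ → ℝ} (hmη : ∀ k A, m k A ≤ η A)
    (hmono : ∀ k, Monotone (m k)) (h0 : ∀ k, m k ∅ ≤ 0)
    (hsub : ∀ k A B, m k (A ∪ B) ≤ m k A + m k B) {A : ℕ → Set Γ} {c : ℝ} (hc : 0 < c)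
    (hA : ∀ k, c ≤ m k (A k)) (hsmall : ∀ i k, i < k → m i (A k) ≤ (1 / 2) ^ k) :
    ∃ c > 0, ∃ B : ℕ → Set Γ, Pairwise (Function.onFun Disjoint B) ∧ ∀ k, c < η (B k) := by
  by_contra! hη
  let U : ℕ → ℕ → Set Γ := fun k n => ⋃ j ∈ Finset.Icc k n, A j
  have hU : ∀ k, Monotone (U k) := fun k a b hab =>
    Set.biUnion_mono (fun j hj => by
      simp only [Finset.coe_Icc, Set.mem_Icc] at hj ⊢
      exact ⟨hj.1, hj.2.trans hab⟩) fun _ _ => subset_rfl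
  choose N hN using fun k => exists_forall_ge_apply_sdiff_le hη (hU k)
    (show 0 < c / 8 * (1 / 2 : ℝ) ^ k by positivity)
  let D : ℕ → Set Γ := fun k => U k (N k)
  have hAD : ∀ j k, j ≤ k → m k (A k \ D j) ≤ c / 8 * (1 / 2) ^ j := fun j k hjk => by
    refine (hmono k ?_).trans ((hmη k _).trans (hN j (max k (N j)) (le_max_right _ _)))
    refine Set.sdiff_subset_sdiff_left ?_
    exact Set.subset_biUnion_of_mem (u := A)
      (Finset.mem_coe.2 (Finset.mem_Icc.2 ⟨hjk, le_max_left _ _⟩))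
  let G : ℕ → Set Γ := fun k => ⋂ j ∈ Finset.range (k + 1), D j
  have hG : ∀ k, 3 * c / 4 ≤ m k (G k) := fun k => by
    have hcover : A k ⊆ G k ∪ ⋃ j ∈ Finset.range (k + 1), (A k \ D j) := fun γ hγ => by
      by_cases h : γ ∈ G k
      · exact Or.inl h
      · simp only [G, Set.mem_iInter, not_forall] at h
        obtain ⟨j, hj, hγj⟩ := h
        exact Or.inr (Set.mem_biUnion (Finset.mem_coe.2 hj) ⟨hγ, hγj⟩)
    have h1 := (hA k).trans ((hmono k hcover).trans (hsub k _ _))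
    have h2 : m k (⋃ j ∈ Finset.range (k + 1), (A k \ D j)) ≤ c / 8 * 2 :=
      calc _ ≤ ∑ j ∈ Finset.range (k + 1), m k (A k \ D j) :=
            apply_biUnion_le_sum (h0 k) (hsub k) _ _
        _ ≤ ∑ j ∈ Finset.range (k + 1), c / 8 * (1 / 2 : ℝ) ^ j :=
            Finset.sum_le_sum fun j hj => hAD j k (Nat.lt_succ_iff.1 (Finset.mem_range.1 hj))
        _ ≤ c / 8 * 2 := by
            rw [← Finset.mul_sum]
            gcongr
            exact sum_geometric_two_le _
    linarith
  have hGsmall : ∀ i k, i < k → m i (G k) ≤ (1 / 2) ^ k * 2 := fun i k hik =>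
    calc m i (G k) ≤ m i (D k) :=
          hmono i (Set.biInter_subset_of_mem (Finset.mem_coe.2 (Finset.self_mem_range_succ k)))
      _ ≤ ∑ j ∈ Finset.Icc k (N k), m i (A j) := apply_biUnion_le_sum (h0 i) (hsub i) _ _
      _ ≤ ∑ j ∈ Finset.Icc k (N k), (1 / 2 : ℝ) ^ j :=
          Finset.sum_le_sum fun j hj => hsmall i j (hik.trans_le (Finset.mem_Icc.1 hj).1)
      _ = (1 / 2) ^ k * ∑ j ∈ Finset.range (N k + 1 - k), (1 / 2 : ℝ) ^ j := by
          rw [← Finset.Ico_add_one_right_eq_Icc, Finset.sum_Ico_eq_sum_range, Finset.mul_sum]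
          simp only [pow_add]
      _ ≤ (1 / 2) ^ k * 2 := by
          gcongr
          exact sum_geometric_two_le _
  have hGanti : Antitone G := fun a b hab =>
    Set.biInter_mono (fun j hj => by
      simp only [Finset.coe_range, Set.mem_Iio] at hj ⊢
      omega) fun _ _ => subset_rfl
  obtain ⟨n, hn⟩ := exists_forall_ge_apply_sdiff_le hη (U := fun k => (G k)ᶜ)
    (fun a b hab => Set.compl_subset_compl.2 (hGanti hab)) (show 0 < c / 4 by positivity)
  obtain ⟨p, hp⟩ := exists_pow_lt_of_lt_one (show 0 < c / 8 by positivity)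
    (show (1 / 2 : ℝ) < 1 by norm_num)
  set r := max p (n + 1)
  have h1 : η (G n \ G r) ≤ c / 4 := by
    have := hn r ((Nat.le_succ n).trans (le_max_right _ _))
    rwa [compl_sdiff_compl] at this
  have h2 : m n (G r) ≤ (1 / 2) ^ r * 2 := hGsmall n r (Nat.lt_of_succ_le (le_max_right _ _))
  have h3 : (1 / 2 : ℝ) ^ r ≤ (1 / 2) ^ p :=
    pow_le_pow_of_le_one (by norm_num) (by norm_num) (le_max_left _ _)
  have h4 : m n (G n) ≤ m n (G n \ G r) + m n (G r) := by
    refine (hmono n ?_).trans (hsub n _ _)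
    rw [Set.sdiff_union_self]
    exact Set.subset_union_left
  linarith [hG n, hmη n (G n \ G r)]

end SetFunction

/-! ### Weak compactness of operators that fix no copy of `ℓ_∞` -/

namespace LInftyC

variable {𝕜 : Type v} [RCLike 𝕜] {Γ I Λ : Type*}

lemma exists_norm_sq_le (f : LInftyC 𝕜 Γ) : ∃ C, ∀ γ, ‖((‖f γ‖ ^ 2 : ℝ) : 𝕜)‖ ≤ C :=
  ⟨‖f‖ ^ 2, fun γ => by
    rw [RCLike.norm_of_nonneg (by positivity)]
    gcongr
    exact norm_apply_le f γ⟩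

/-- The value `|ν|(|f|²)` of the variation of `ν` at the function `|f|²`. -/
noncomputable def sqVariation (ν : LInftyC 𝕜 Γ →L[𝕜] 𝕜) (f : LInftyC 𝕜 Γ) : ℝ :=
  ‖ν ∘L mulOp (fun γ => ((‖f γ‖ ^ 2 : ℝ) : 𝕜)) (exists_norm_sq_le f)‖

lemma sqVariation_nonneg (ν : LInftyC 𝕜 Γ →L[𝕜] 𝕜) (f : LInftyC 𝕜 Γ) : 0 ≤ sqVariation ν f :=
  norm_nonneg _

lemma sqVariation_le_norm (ν : LInftyC 𝕜 Γ →L[𝕜] 𝕜) {f : LInftyC 𝕜 Γ} (hf : ‖f‖ ≤ 1) :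
    sqVariation ν f ≤ ‖ν‖ := by
  refine ContinuousLinearMap.opNorm_le_bound _ (norm_nonneg _) fun x => (ν.le_opNorm _).trans ?_
  gcongr
  refine norm_le (norm_nonneg _) fun γ => ?_
  change ‖((‖f γ‖ ^ 2 : ℝ) : 𝕜) * x γ‖ ≤ ‖x‖
  rw [norm_mul, RCLike.norm_of_nonneg (by positivity)]
  exact (mul_le_of_le_one_left (norm_nonneg _)
    (pow_le_one₀ (norm_nonneg _) ((norm_apply_le f γ).trans hf))).trans (norm_apply_le x γ)

lemma sqVariation_parallelogram (ν : LInftyC 𝕜 Γ →L[𝕜] 𝕜) (f g : LInftyC 𝕜 Γ) :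
    sqVariation ν (f + g) + sqVariation ν (f - g) = 2 * sqVariation ν f + 2 * sqVariation ν g := by
  have hb : ∃ C, ∀ γ, ‖((‖f γ‖ ^ 2 + ‖g γ‖ ^ 2 : ℝ) : 𝕜)‖ ≤ C := by
    obtain ⟨C, hC⟩ := exists_norm_sq_le f
    obtain ⟨D, hD⟩ := exists_norm_sq_le g
    refine ⟨C + D, fun γ => ?_⟩
    rw [RCLike.ofReal_add]
    exact (norm_add_le _ _).trans (add_le_add (hC γ) (hD γ))
  have hb2 : ∃ C, ∀ γ, ‖(((‖f γ‖ ^ 2 + ‖g γ‖ ^ 2) + (‖f γ‖ ^ 2 + ‖g γ‖ ^ 2) : ℝ) : 𝕜)‖ ≤ C := by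
    obtain ⟨C, hC⟩ := hb
    refine ⟨C + C, fun γ => ?_⟩
    rw [RCLike.ofReal_add]
    exact (norm_add_le _ _).trans (add_le_add (hC γ) (hC γ))
  have h1 := norm_comp_mulOp_add ν (fun γ => ‖f γ‖ ^ 2) (fun γ => ‖g γ‖ ^ 2) _
    (fun γ => by positivity) (fun γ => by positivity) (fun γ => rfl)
    (exists_norm_sq_le f) (exists_norm_sq_le g) hb
  have h2 := norm_comp_mulOp_add ν (fun γ => ‖f γ‖ ^ 2 + ‖g γ‖ ^ 2)
    (fun γ => ‖f γ‖ ^ 2 + ‖g γ‖ ^ 2) _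
    (fun γ => by positivity) (fun γ => by positivity) (fun γ => rfl) hb hb hb2
  have h3 := norm_comp_mulOp_add ν (fun γ => ‖(f + g) γ‖ ^ 2) (fun γ => ‖(f - g) γ‖ ^ 2)
    (fun γ => (‖f γ‖ ^ 2 + ‖g γ‖ ^ 2) + (‖f γ‖ ^ 2 + ‖g γ‖ ^ 2))
    (fun γ => by positivity) (fun γ => by positivity) (fun γ => by
      have := parallelogram_law_with_norm 𝕜 (f γ) (g γ)
      rw [add_apply, sub_apply, this]
      ring)
    (exists_norm_sq_le (f + g)) (exists_norm_sq_le (f - g)) hb2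
  unfold sqVariation
  linarith

/-- Chebyshev's inequality. -/
lemma variation_le_sqVariation (ν : LInftyC 𝕜 Γ →L[𝕜] 𝕜) (f : LInftyC 𝕜 Γ) {t : ℝ} (ht : 0 < t) :
    variation ν {γ | t ≤ ‖f γ‖} ≤ (t ^ 2)⁻¹ * sqVariation ν f := by
  refine ContinuousLinearMap.opNorm_le_bound _
    (mul_nonneg (by positivity) (sqVariation_nonneg _ _)) fun x => ?_
  set A := {γ | t ≤ ‖f γ‖}
  have hbd : ∀ γ, ‖((‖f γ‖ ^ 2 : ℝ) : 𝕜)⁻¹ * proj A x γ‖ ≤ (t ^ 2)⁻¹ * ‖x‖ := fun γ => by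
    by_cases hγ : γ ∈ A
    · rw [proj_apply_of_mem hγ, norm_mul, norm_inv, RCLike.norm_of_nonneg (by positivity)]
      exact mul_le_mul (inv_anti₀ (by positivity) (pow_le_pow_left₀ ht.le hγ 2))
        (norm_apply_le x γ) (norm_nonneg _) (by positivity)
    · rw [proj_apply_of_notMem hγ, mul_zero, norm_zero]
      positivity
  let h : LInftyC 𝕜 Γ := ofFun (fun γ => ((‖f γ‖ ^ 2 : ℝ) : 𝕜)⁻¹ * proj A x γ) ⟨_, hbd⟩
    ((proj A x).countable_support.mono fun γ hγ => right_ne_zero_of_mul hγ)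
  have hh : mulOp (fun γ => ((‖f γ‖ ^ 2 : ℝ) : 𝕜)) (exists_norm_sq_le f) h = proj A x := by
    ext γ
    rw [mulOp_apply, ofFun_apply]
    by_cases hγ : γ ∈ A
    · have h0 : ‖f γ‖ ≠ 0 := (ht.trans_le hγ).ne'
      rw [mul_inv_cancel_left₀ (RCLike.ofReal_ne_zero.2 (pow_ne_zero 2 h0))]
    · rw [proj_apply_of_notMem hγ, mul_zero, mul_zero]
  rw [ContinuousLinearMap.comp_apply, ← hh, mul_assoc, mul_left_comm]
  refine ((ν ∘L mulOp _ (exists_norm_sq_le f)).le_opNorm h).trans ?_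
  exact mul_le_mul_of_nonneg_left (norm_le (by positivity) hbd) (norm_nonneg _)

/-- Suppose that `‖T P_B‖` is not bounded away from zero along any disjoint sequence of sets `B`.
Then finitely many coordinate functionals `ν` of `T` control `T`: the values of `T` on the unit
ball are small where the sum of the `|ν|(|f|²)` is small. -/
lemma exists_finset_sum_sqVariation (T : LInftyC 𝕜 Γ →L[𝕜] LInftyC 𝕜 Λ)
    (hT : ¬ ∃ c > 0, ∃ B : ℕ → Set Γ, Pairwise (Function.onFun Disjoint B) ∧
      ∀ k, c < ‖T ∘L proj (B k)‖) {ε : ℝ} (hε : 0 < ε) :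
    ∃ (F : Finset Λ), ∃ δ > 0, ∀ f : LInftyC 𝕜 Γ, ‖f‖ ≤ 1 →
      ∑ g ∈ F, sqVariation (coord g ∘L T) f < δ → ‖T f‖ ≤ ε := by
  classical
  by_contra! hcon
  -- a sequence `f k` with `(T f k) (g k)` large and negligible for the coordinates `g i`, `i < k`
  have hcon' : ∀ (F : Finset Λ) (δ : ℝ), ∃ (f : LInftyC 𝕜 Γ) (g : Λ), 0 < δ → ‖f‖ ≤ 1 ∧
      ∑ g ∈ F, sqVariation (coord g ∘L T) f < δ ∧ ε < ‖T f g‖ := fun F δ => by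
    by_cases hδ : 0 < δ
    · obtain ⟨f, h1, h2, h3⟩ := hcon F δ hδ
      obtain ⟨g, hg⟩ := exists_lt_norm_apply hε.le h3
      exact ⟨f, g, fun _ => ⟨h1, h2, hg⟩⟩
    · have hne : Nonempty Λ := by
        obtain ⟨f, -, -, h3⟩ := hcon ∅ 1 one_pos
        obtain ⟨g, -⟩ := exists_lt_norm_apply hε.le h3
        exact ⟨g⟩
      exact ⟨0, hne.some, fun h => absurd h hδ⟩
  choose f g hfg using hcon'
  set t := ε / (2 * (‖T‖ + 1)) with ht
  have htpos : 0 < t := by positivity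
  have hδ : ∀ k : ℕ, 0 < t ^ 2 * (1 / 2 : ℝ) ^ k := fun k => by positivity
  let F : ℕ → Finset Λ := fun n =>
    n.rec ∅ fun k S => insert (g S (t ^ 2 * (1 / 2 : ℝ) ^ k)) S
  let a : ℕ → LInftyC 𝕜 Γ := fun k => f (F k) (t ^ 2 * (1 / 2 : ℝ) ^ k)
  let b : ℕ → Λ := fun k => g (F k) (t ^ 2 * (1 / 2 : ℝ) ^ k)
  have hF : ∀ k, F (k + 1) = insert (b k) (F k) := fun k => rfl
  have hbF : ∀ i k, i < k → b i ∈ F k := fun i k hik => by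
    induction k with
    | zero => exact absurd hik (Nat.not_lt_zero i)
    | succ k ih =>
      rw [hF]
      rcases Nat.lt_succ_iff_lt_or_eq.1 hik with h | rfl
      · exact Finset.mem_insert_of_mem (ih h)
      · exact Finset.mem_insert_self _ _
  have hab : ∀ k, ‖a k‖ ≤ 1 ∧ ∑ g ∈ F k, sqVariation (coord g ∘L T) (a k) <
      t ^ 2 * (1 / 2 : ℝ) ^ k ∧ ε < ‖T (a k) (b k)‖ := fun k => hfg _ _ (hδ k)
  have hnorm : ∀ g : Λ, ‖coord g ∘L T‖ ≤ ‖T‖ := fun g =>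
    (ContinuousLinearMap.opNorm_comp_le _ _).trans
      (mul_le_of_le_one_left (norm_nonneg _) (norm_coord_le _))
  refine hT (exists_disjoint_lt_of_dominated (m := fun k => variation (coord (b k) ∘L T))
    (η := fun B => ‖T ∘L proj B‖) (A := fun k => {γ | t ≤ ‖a k γ‖}) (c := ε / 2)
    (fun k A => ?_) (fun k A B h => variation_mono _ h) (fun k => ?_)
    (fun k A B => variation_union_le _ A B) (half_pos hε) (fun k => ?_) fun i k hik => ?_)
  · rw [variation, ContinuousLinearMap.comp_assoc]
    exact (ContinuousLinearMap.opNorm_comp_le _ _).trans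
      (mul_le_of_le_one_left (norm_nonneg _) (norm_coord_le _))
  · refine ContinuousLinearMap.opNorm_le_bound _ le_rfl fun x => ?_
    have : proj (∅ : Set Γ) x = 0 := by
      ext γ
      exact proj_apply_of_notMem (Set.notMem_empty γ) x
    simp [this]
  · obtain ⟨h1, -, h3⟩ := hab k
    set A := {γ | t ≤ ‖a k γ‖}
    have h4 : ‖proj Aᶜ (a k)‖ ≤ t := norm_le htpos.le fun γ => by
      by_cases hγ : γ ∈ A
      · rw [proj_apply_of_notMem (Set.notMem_compl_iff.2 hγ), norm_zero]
        exact htpos.le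
      · rw [proj_apply_of_mem (Set.mem_compl hγ)]
        exact (not_le.1 hγ).le
    have h5 : ‖T (a k) (b k)‖ ≤ ‖(coord (b k) ∘L T) (proj A (a k))‖ +
        ‖(coord (b k) ∘L T) (proj Aᶜ (a k))‖ := by
      rw [← coord_apply, ← ContinuousLinearMap.comp_apply]
      conv_lhs => rw [← proj_add_proj_compl A (a k), map_add]
      exact norm_add_le _ _
    have h6 := (norm_apply_proj_le (coord (b k) ∘L T) A (a k)).trans
      (mul_le_of_le_one_right (variation_nonneg _ _) h1)
    have h7 : ‖(coord (b k) ∘L T) (proj Aᶜ (a k))‖ ≤ ε / 2 :=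
      calc _ ≤ ‖T‖ * t := ((coord (b k) ∘L T).le_opNorm _).trans
            (mul_le_mul (hnorm _) h4 (norm_nonneg _) (norm_nonneg _))
        _ ≤ (‖T‖ + 1) * t := by gcongr; linarith
        _ = ε / 2 := by rw [ht]; field_simp
    linarith
  · refine (variation_le_sqVariation _ _ htpos).trans ?_
    rw [inv_mul_le_iff₀ (by positivity)]
    exact (Finset.single_le_sum (f := fun g => sqVariation (coord g ∘L T) (a k))
      (fun _ _ => sqVariation_nonneg _ _) (hbF i k hik)).trans (hab k).2.1.le

/-- An operator from `ℓ_∞^c(Γ)` to `ℓ_∞^c(Λ)` that is not weakly compact fixes a copy of `ℓ_∞`, here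
`ℓ_∞^c(I)` for a countable infinite set `I`. -/
theorem isWeaklyCompactOperator_of_not_isBoundedBelowOnCopyOf [Countable I] [Infinite I]
    (T : LInftyC 𝕜 Γ →L[𝕜] LInftyC 𝕜 Λ) (hT : ¬ IsBoundedBelowOnCopyOf (LInftyC 𝕜 I) T) :
    IsWeaklyCompactOperator T := by
  have hexh : ¬ ∃ c > 0, ∃ B : ℕ → Set Γ, Pairwise (Function.onFun Disjoint B) ∧
      ∀ k, c < ‖T ∘L proj (B k)‖ := by
    rintro ⟨c, hc, B, hB, hlt⟩
    obtain ⟨e, he⟩ := exists_injective_nat I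
    obtain ⟨A, S, h⟩ := exists_comp_comp_eq_id_of_lt_norm_comp_proj T hc (fun i => B (e i))
      (fun i j hij => hB (he.ne hij)) fun i => hlt (e i)
    exact hT (isBoundedBelowOnCopyOf_of_comp_comp_eq_id T A S h)
  refine isWeaklyCompactOperator_of_parallelogram T fun ε hε => ?_
  obtain ⟨F, δ, hδ, hF⟩ := exists_finset_sum_sqVariation T hexh hε
  refine ⟨fun f => ∑ g ∈ F, sqVariation (coord g ∘L T) f,
    fun f => Finset.sum_nonneg fun _ _ => sqVariation_nonneg _ _,
    ⟨∑ g ∈ F, ‖coord g ∘L T‖, fun f hf => Finset.sum_le_sum fun g _ => sqVariation_le_norm _ hf⟩,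
    fun x y => ?_, δ, hδ, hF⟩
  rw [← Finset.sum_add_distrib, Finset.mul_sum, Finset.mul_sum, ← Finset.sum_add_distrib]
  exact Finset.sum_congr rfl fun g _ => sqVariation_parallelogram _ x y

/-! ### Operators concentrated on small sets -/

/-- A projection onto a band factors through any `ℓ_∞^c(I)` with `I` nonempty and not smaller than
the band. -/
lemma exists_proj_eq_comp {Γ I : Type u} [Nonempty I] {S : Set Γ} (h : #S ≤ #I) :
    ∃ (C : LInftyC 𝕜 Γ →L[𝕜] LInftyC 𝕜 I) (D : LInftyC 𝕜 I →L[𝕜] LInftyC 𝕜 Γ),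
      proj S = D ∘L C := by
  classical
  obtain ⟨e⟩ := h
  rcases S.eq_empty_or_nonempty with rfl | ⟨s₀, hs₀⟩
  · refine ⟨0, 0, ?_⟩
    ext x γ
    exact proj_apply_of_notMem (Set.notMem_empty γ) x
  have hne : Nonempty S := ⟨⟨s₀, hs₀⟩⟩
  let φ : Γ → I := fun γ => if h : γ ∈ S then e ⟨γ, h⟩ else Classical.arbitrary I
  let ψ : I → Γ := fun i => (Function.invFun e i : S)
  have hψφ : ∀ γ ∈ S, ψ (φ γ) = γ := fun γ hγ => by
    simp only [ψ, φ, dif_pos hγ]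
    rw [Function.leftInverse_invFun e.injective]
  have hφψ : ∀ i ∈ Set.range e, φ (ψ i) = i := by
    rintro _ ⟨s, rfl⟩
    simp only [ψ, φ, Function.leftInverse_invFun e.injective s, Subtype.coe_prop, dif_pos,
      Subtype.coe_eta]
  refine ⟨weightedComp ψ ((Set.range e).indicator 1)
    ⟨1, fun i => by by_cases h : i ∈ Set.range e <;> simp [h]⟩ fun γ =>
      (Set.countable_singleton (φ γ)).mono ?_,
    weightedComp φ (S.indicator 1) ⟨1, fun γ => by by_cases h : γ ∈ S <;> simp [h]⟩ fun i =>
      (Set.countable_singleton (ψ i)).mono ?_, ?_⟩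
  · rintro i ⟨rfl, hi⟩
    exact (hφψ i (Set.mem_of_indicator_ne_zero hi)).symm
  · rintro γ ⟨rfl, hγ⟩
    exact (hψφ γ (Set.mem_of_indicator_ne_zero hγ)).symm
  · ext x γ
    rw [ContinuousLinearMap.comp_apply, weightedComp_apply, weightedComp_apply]
    by_cases hγ : γ ∈ S
    · have : φ γ ∈ Set.range e := ⟨⟨γ, hγ⟩, by simp [φ, hγ]⟩
      rw [proj_apply_of_mem hγ, Set.indicator_of_mem hγ, Set.indicator_of_mem this, hψφ γ hγ]
      simp
    · rw [proj_apply_of_notMem hγ, Set.indicator_of_notMem hγ, zero_mul]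

/-- For uncountable `κ`, an operator that fixes no copy of `ℓ_∞^c(κ)` is, up to `ε`, concentrated
on a set of cardinality less than `κ`, namely the union of a maximal disjoint family of countable
sets on which the operator has norm larger than `ε`. -/
lemma exists_mk_lt_norm_comp_proj_compl_le {Γ I : Type u} {Λ : Type*} (hI : ℵ₀ < #I)
    (T : LInftyC 𝕜 Γ →L[𝕜] LInftyC 𝕜 Λ) (hT : ¬ IsBoundedBelowOnCopyOf (LInftyC 𝕜 I) T)
    {ε : ℝ} (hε : 0 < ε) : ∃ S : Set Γ, #S < #I ∧ ‖T ∘L proj Sᶜ‖ ≤ ε := by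
  have : Infinite I := Cardinal.infinite_iff.2 hI.le
  obtain ⟨F, ⟨hFdisj, hF⟩, hmax⟩ := zorn_subset
    {F : Set (Set Γ) | F.PairwiseDisjoint id ∧ ∀ A ∈ F, A.Countable ∧ ε < ‖T ∘L proj A‖}
    fun c hc hchain => ⟨⋃₀ c, ⟨(Set.pairwiseDisjoint_sUnion hchain.directedOn).2
      fun F hF => (hc hF).1, fun A ⟨F, hF, hA⟩ => (hc hF).2 A hA⟩,
      fun F hF => Set.subset_sUnion_of_mem hF⟩
  have hFI : #F < #I := by
    by_contra! h
    obtain ⟨e⟩ := h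
    obtain ⟨A, B, hAB⟩ := exists_comp_comp_eq_id_of_lt_norm_comp_proj T hε (fun i => (e i : Set Γ))
      (fun i j hij => hFdisj (e i).2 (e j).2 fun h => hij (e.injective (Subtype.ext h)))
      fun i => (hF _ (e i).2).2
    exact hT (isBoundedBelowOnCopyOf_of_comp_comp_eq_id T A B hAB)
  refine ⟨⋃₀ F, ?_, ?_⟩
  · calc #(⋃₀ F) ≤ #F * ⨆ s : F, #s := Cardinal.mk_sUnion_le F
      _ ≤ #F * ℵ₀ := by
          gcongr
          exact ciSup_le' fun s => (hF s s.2).1.le_aleph0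
      _ < #I := Cardinal.mul_lt_of_lt hI.le hFI hI
  · by_contra! hlt
    obtain ⟨f, hf, hTf⟩ := exists_lt_norm_apply_of_lt_opNorm _ hlt
    rw [ContinuousLinearMap.comp_apply] at hTf
    set f' := proj (⋃₀ F)ᶜ f with hf'
    let A : Set Γ := {γ | f' γ ≠ 0}
    have hA : proj A f' = f' := by
      ext γ
      by_cases hγ : γ ∈ A
      · exact proj_apply_of_mem hγ _
      · rw [proj_apply_of_notMem hγ]
        exact (not_not.1 hγ).symm
    have hTA : ε < ‖T ∘L proj A‖ := by
      have h1 := (T ∘L proj A).unit_le_opNorm f' ((norm_proj_apply_le _ _).trans hf)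
      rw [ContinuousLinearMap.comp_apply, hA] at h1
      exact hTf.trans_le h1
    have hAF : A ⊆ (⋃₀ F)ᶜ := fun γ hγ => by
      by_contra h
      exact hγ (proj_apply_of_notMem h f)
    have hins : insert A F ∈ {F : Set (Set Γ) | F.PairwiseDisjoint id ∧
        ∀ A ∈ F, A.Countable ∧ ε < ‖T ∘L proj A‖} := by
      refine ⟨hFdisj.insert fun B hB _ => ?_, ?_⟩
      · exact Set.disjoint_left.2 fun γ hγ hγB => hAF hγ ⟨B, hB, hγB⟩
      · rintro B (rfl | hB)
        · exact ⟨f'.countable_support, hTA⟩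
        · exact hF B hB
    have hAmem : A ∈ F := hmax hins (Set.subset_insert A F) (Set.mem_insert A F)
    have hA0 : f' = 0 := by
      ext γ
      by_contra hγ
      exact hAF (show γ ∈ A from hγ) ⟨A, hAmem, hγ⟩
    rw [hA0, map_zero, norm_zero] at hTf
    exact hTf.not_gt hε

end LInftyC

/-! ### Closed ideals that contain the weakly compact operators -/

/-- An ideal that contains an operator fixing a copy of `ℓ_∞^c(I)` contains all operators that
factor through `ℓ_∞^c(I)`. -/
lemma comp_mem_of_isBoundedBelowOnCopyOf {𝕜 : Type v} [RCLike 𝕜] {Γ I : Type*} [Infinite I]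
    (J : TwoSidedIdeal (LInftyC 𝕜 Γ →L[𝕜] LInftyC 𝕜 Γ)) {R : LInftyC 𝕜 Γ →L[𝕜] LInftyC 𝕜 Γ}
    (hR : R ∈ J) (h : IsBoundedBelowOnCopyOf (LInftyC 𝕜 I) R)
    (C : LInftyC 𝕜 Γ →L[𝕜] LInftyC 𝕜 I) (D : LInftyC 𝕜 I →L[𝕜] LInftyC 𝕜 Γ) : D ∘L C ∈ J := by
  obtain ⟨A, B, hAB⟩ := LInftyC.exists_comp_comp_eq_id_of_isBoundedBelowOnCopyOf h
  have : D ∘L C = (D ∘L B) * R * (A ∘L C) := by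
    ext1 x
    exact congrArg D (DFunLike.congr_fun hAB (C x)).symm
  rw [this]
  exact J.mul_mem_right _ _ (J.mul_mem_left _ _ hR)

theorem theorem1p2 {𝕜 : Type v} [RCLike 𝕜] (lam : Cardinal.{u}) (hlam : ℵ₀ ≤ lam)
    (J : TwoSidedIdeal (EllInftyC 𝕜 lam →L[𝕜] EllInftyC 𝕜 lam))
    (hJ_closed : IsClosed (J : Set (EllInftyC 𝕜 lam →L[𝕜] EllInftyC 𝕜 lam)))
    (hJ_wc : ∀ T : EllInftyC 𝕜 lam →L[𝕜] EllInftyC 𝕜 lam, IsWeaklyCompactOperator T → T ∈ J) :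
    ∃ κ : Cardinal.{u}, ℵ₀ ≤ κ ∧ κ ≤ Order.succ lam ∧
      (J : Set (EllInftyC 𝕜 lam →L[𝕜] EllInftyC 𝕜 lam)) =
        singularOperators 𝕜 (EllInftyC 𝕜 κ) (EllInftyC 𝕜 lam) := by
  have hinf : ∀ {μ : Cardinal.{u}}, ℵ₀ ≤ μ → Infinite μ.ord.ToType := fun h =>
    Cardinal.infinite_iff.2 (by rwa [Cardinal.mk_ord_toType])
  have : Infinite lam.ord.ToType := hinf hlam
  let K : Set Cardinal.{u} := {κ | ℵ₀ ≤ κ ∧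
    (J : Set (EllInftyC 𝕜 lam →L[𝕜] EllInftyC 𝕜 lam)) ⊆
      singularOperators 𝕜 (EllInftyC 𝕜 κ) (EllInftyC 𝕜 lam)}
  have hsucc : Order.succ lam ∈ K := ⟨hlam.trans (Order.le_succ lam), fun T _ =>
    LInftyC.not_isBoundedBelowOnCopyOf_of_mk_lt
      (by simpa only [Cardinal.mk_ord_toType] using Order.lt_succ lam) T⟩
  obtain ⟨hκ, hJκ⟩ : sInf K ∈ K := csInf_mem ⟨_, hsucc⟩
  refine ⟨sInf K, hκ, csInf_le' hsucc, hJκ.antisymm fun T hT => ?_⟩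
  have hκinf := hinf hκ
  rcases hκ.eq_or_lt with hω | hω
  · have : Countable (sInf K).ord.ToType := by
      rw [← Cardinal.mk_le_aleph0_iff, Cardinal.mk_ord_toType, ← hω]
    exact hJ_wc T (LInftyC.isWeaklyCompactOperator_of_not_isBoundedBelowOnCopyOf T hT)
  · rw [← hJ_closed.closure_eq, Metric.mem_closure_iff]
    intro ε hε
    obtain ⟨S, hS, hTS⟩ := LInftyC.exists_mk_lt_norm_comp_proj_compl_le
      (by rwa [Cardinal.mk_ord_toType]) T hT (half_pos hε)
    rw [Cardinal.mk_ord_toType] at hS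
    -- `T P_S` factors through `ℓ_∞^c(μ)`, and `μ < κ` is such that `J` fixes a copy of `ℓ_∞^c(μ)`
    set μ := max #S ℵ₀
    have hμ : ℵ₀ ≤ μ := le_max_right _ _
    have hμinf := hinf hμ
    have hμK : μ ∉ K := notMem_of_lt_csInf' (max_lt hS hω)
    obtain ⟨R, hRJ, hR⟩ := Set.not_subset.1 fun h => hμK ⟨hμ, h⟩
    obtain ⟨C, D, hCD⟩ := LInftyC.exists_proj_eq_comp (𝕜 := 𝕜) (S := S) (I := μ.ord.ToType)
      (by rw [Cardinal.mk_ord_toType]; exact le_max_left _ _)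
    refine ⟨T * LInftyC.proj S, ?_, ?_⟩
    · rw [hCD]
      exact J.mul_mem_left _ _ (comp_mem_of_isBoundedBelowOnCopyOf J hRJ (not_not.1 hR) C D)
    · have : T - T * LInftyC.proj S = T ∘L LInftyC.proj Sᶜ := by
        ext1 x
        change T x - T (LInftyC.proj S x) = T (LInftyC.proj Sᶜ x)
        rw [← map_sub]
        congr 1
        rw [sub_eq_iff_eq_add', LInftyC.proj_add_proj_compl]
      rw [dist_eq_norm, this]
      linarith
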